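/- For bipartite graphs $G$, $H$ and a positive integer $m$, let $BR_m(G,H)$ denote the smallest positive integer $n$ such that every red-blue coloring of the edges of the complete bipartite graph $K_{m,n}$ contains a red copy of $G$ or a blue copy of $H$ (as a subgraph, not necessarily induced); if there is no such $n$, we say that $BR_m(G,H)$ does not exist. Let $m\ge 2$ be an integer. Then: \begin{itemize} \item if $m\in\{2,3\}$, then $BR_m(K_{2,2},K_{3,3})$ does not exist; \item if $m=4$, then $BR_m(K_{2,2},K_{3,3})=15$; \item if $m\in\{5,6\}$, then $BR_m(K_{2,2},K_{3,3})=12$; \item if $m\in\{7,8\}$, then $BR_m(K_{2,2},K_{3,3})=9$. \end{itemize} -/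

import Mathlib

/-- `MBipartiteArrows m n G H`: every red-blue coloring of the edges of `K_{m,n}` contains a red
copy of `G` or a blue copy of `H`. Red is the label `true`, blue is the label `false`; a copy is a
(not necessarily induced) subgraph isomorphic to the given graph. -/
def MBipartiteArrows (m n : ℕ) {V W : Type*} (G : SimpleGraph V) (H : SimpleGraph W) : Prop :=
  ∀ C : (completeBipartiteGraph (Fin m) (Fin n)).EdgeLabeling Bool,
    G.IsContained (C.labelGraph true) ∨ H.IsContained (C.labelGraph false)

/-- `IsMBipartiteRamseyNumber m G H N`: the `m`-bipartite Ramsey number `BR_m(G, H)` exists and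
equals `N`, that is, `N` is the smallest positive integer `n` such that every red-blue coloring of
`K_{m,n}` results in a red `G` or a blue `H`. -/
def IsMBipartiteRamseyNumber (m : ℕ) {V W : Type*} (G : SimpleGraph V) (H : SimpleGraph W)
    (N : ℕ) : Prop :=
  IsLeast {n : ℕ | 0 < n ∧ MBipartiteArrows m n G H} N

/-- The complete bipartite graph `K_{s,t}`. -/
abbrev KBip (s t : ℕ) : SimpleGraph (Fin s ⊕ Fin t) :=
  completeBipartiteGraph (Fin s) (Fin t)

/-! A colouring of `K_{m,n}` is a family of `n` red neighbourhoods in the `m` rows. It avoids both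
forbidden graphs iff two members always share at most one row and three members always miss at most
two rows. Such good families restrict to fewer rows or columns, so each value needs only an upper
bound at the smallest `m` of its range and a lower bound at the largest. Lower bounds are explicit
families (`not_mBipartiteArrows_of_masks`). Upper bounds come from an exhaustive search evaluated in
the kernel, whose completeness is `existsFamily_eq_true`. A row permutation makes one member an
initial segment, and members are picked in list order. -/

open Finset

/-! ### Reformulation in terms of red neighbourhoods -/

/-- The red neighbourhoods of the columns of a colouring of `K_{m,n}` with no red `K_{2,2}` and no
blue `K_{3,3}`: two columns share at most one red row, and three columns share at most two blue
rows. -/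
def IsGoodFamily {m n : ℕ} (c : Fin n → Finset (Fin m)) : Prop :=
  (∀ i j, i ≠ j → #(c i ∩ c j) ≤ 1) ∧
    ∀ i j k, i ≠ j → i ≠ k → j ≠ k → #(c i ∪ c j ∪ c k)ᶜ ≤ 2

theorem SimpleGraph.adj_completeBipartiteGraph_inl_inr {α β : Type*} (a : α) (b : β) :
    (completeBipartiteGraph α β).Adj (Sum.inl a) (Sum.inr b) := by
  simp

/-- A monochromatic `K_{s,s}` in a colouring of `K_{m,n}`, with `s > 0`, amounts to `s` rows and
`s` columns all of whose crossings have the same colour. -/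
theorem kBip_isContained_labelGraph_iff {m n s : ℕ} (hs : 0 < s) {K : Type*}
    (C : (completeBipartiteGraph (Fin m) (Fin n)).EdgeLabeling K) (k : K) :
    (KBip s s).IsContained (C.labelGraph k) ↔
      ∃ (a : Fin s ↪ Fin m) (b : Fin s ↪ Fin n), ∀ i j,
        C ⟨s(Sum.inl (a i), Sum.inr (b j)),
          SimpleGraph.adj_completeBipartiteGraph_inl_inr _ _⟩ = k := by
  constructor
  · rintro ⟨φ⟩
    have hadj : ∀ i j, (C.labelGraph k).Adj (φ (Sum.inl i)) (φ (Sum.inr j)) := fun i j =>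
      φ.toHom.map_rel (SimpleGraph.adj_completeBipartiteGraph_inl_inr i j)
    have hl : Function.Injective fun i => φ (Sum.inl i) :=
      φ.injective.comp Sum.inl_injective
    have hr : Function.Injective fun i => φ (Sum.inr i) :=
      φ.injective.comp Sum.inr_injective
    -- A copy may place either side of `K_{s,s}` in the rows. One vertex decides which, and the two
    -- sides are interchangeable.
    have key : ∀ f g : Fin s → Fin m ⊕ Fin n, Function.Injective f → Function.Injective g →
        (∀ i j, (C.labelGraph k).Adj (f i) (g j)) → (f ⟨0, hs⟩).isLeft →
        ∃ (a : Fin s ↪ Fin m) (b : Fin s ↪ Fin n), ∀ i j,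
        C ⟨s(Sum.inl (a i), Sum.inr (b j)),
          SimpleGraph.adj_completeBipartiteGraph_inl_inr _ _⟩ = k := by
      intro f g hf hg hfg h0
      have hgr : ∀ j, (g j).isRight := by
        intro j
        have := C.labelGraph_le (hfg ⟨0, hs⟩ j)
        cases h : f ⟨0, hs⟩ <;> cases h' : g j <;> simp_all
      have hfl : ∀ i, (f i).isLeft := by
        intro i
        have := C.labelGraph_le (hfg i ⟨0, hs⟩)
        have := hgr ⟨0, hs⟩
        cases h : f i <;> cases h' : g ⟨0, hs⟩ <;> simp_all
      have ha : ∀ i, ∃ x, f i = Sum.inl x := fun i => Sum.isLeft_iff.1 (hfl i)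
      have hb : ∀ i, ∃ x, g i = Sum.inr x := fun i => Sum.isRight_iff.1 (hgr i)
      choose a ha using ha
      choose b hb using hb
      refine ⟨⟨a, fun i j h => hf (by rw [ha, ha, h])⟩, ⟨b, fun i j h => hg (by rw [hb, hb, h])⟩,
        fun i j => ?_⟩
      have := hfg i j
      rw [ha, hb, SimpleGraph.EdgeLabeling.labelGraph_adj] at this
      exact this.2
    cases h : φ (Sum.inl ⟨0, hs⟩) with
    | inl x => exact key _ _ hl hr hadj (by simp [h])
    | inr x =>
      refine key _ _ hr hl (fun i j => (hadj j i).symm) ?_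
      have := C.labelGraph_le (hadj ⟨0, hs⟩ ⟨0, hs⟩)
      rw [h] at this
      cases h' : φ (Sum.inr ⟨0, hs⟩) <;> simp_all
  · rintro ⟨a, b, h⟩
    refine ⟨⟨⟨Sum.map a b, ?_⟩, Sum.map_injective.2 ⟨a.injective, b.injective⟩⟩⟩
    rintro (i | i) (j | j) hij
    · simp at hij
    · exact (SimpleGraph.EdgeLabeling.labelGraph_adj _ _).2
        ⟨SimpleGraph.adj_completeBipartiteGraph_inl_inr _ _, h i j⟩
    · exact ((SimpleGraph.EdgeLabeling.labelGraph_adj _ _).2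
        ⟨SimpleGraph.adj_completeBipartiteGraph_inl_inr _ _, h j i⟩).symm
    · simp at hij

theorem Finset.exists_embedding_of_le_card {α : Type*} {s : Finset α} {k : ℕ} (h : k ≤ #s) :
    ∃ a : Fin k ↪ α, ∀ i, a i ∈ s := by
  obtain ⟨t, hts, htk⟩ := exists_subset_card_eq h
  exact ⟨(t.equivFinOfCardEq htk).symm.toEmbedding.trans (.subtype _),
    fun i => hts ((t.equivFinOfCardEq htk).symm i).2⟩

theorem Finset.le_card_of_embedding {α : Type*} {s : Finset α} {k : ℕ} (a : Fin k ↪ α)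
    (h : ∀ i, a i ∈ s) : k ≤ #s := by
  classical
  calc k = #(univ.map a) := by simp
    _ ≤ #s := card_le_card fun x hx => by
      obtain ⟨i, -, rfl⟩ := mem_map.1 hx
      exact h i

/-- A family of red neighbourhoods is good iff the colouring has no monochromatic rectangle of the
forbidden kinds. -/
theorem isGoodFamily_iff {m n : ℕ} (c : Fin n → Finset (Fin m)) :
    IsGoodFamily c ↔
      (¬ ∃ (a : Fin 2 ↪ Fin m) (b : Fin 2 ↪ Fin n), ∀ i j, a i ∈ c (b j)) ∧
      ¬ ∃ (a : Fin 3 ↪ Fin m) (b : Fin 3 ↪ Fin n), ∀ i j, a i ∉ c (b j) := by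
  constructor
  · rintro ⟨h2, h3⟩
    constructor
    · rintro ⟨a, b, h⟩
      have := le_card_of_embedding (s := c (b 0) ∩ c (b 1)) a fun i => by simp [h]
      have := h2 (b 0) (b 1) (by simp)
      omega
    · rintro ⟨a, b, h⟩
      have := le_card_of_embedding (s := (c (b 0) ∪ c (b 1) ∪ c (b 2))ᶜ) a fun i => by simp [h]
      have := h3 (b 0) (b 1) (b 2) (by simp) (by simp) (by simp)
      omega
  · rintro ⟨h2, h3⟩
    constructor
    · intro i j hij
      by_contra! hc
      obtain ⟨a, ha⟩ := exists_embedding_of_le_card (k := 2) hc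
      refine h2 ⟨a, ⟨![i, j], ?_⟩, fun x y => ?_⟩
      · intro x y
        fin_cases x <;> fin_cases y <;> simp [hij, hij.symm]
      · have := mem_inter.1 (ha x)
        fin_cases y
        exacts [this.1, this.2]
    · intro i j k hij hik hjk
      by_contra! hc
      obtain ⟨a, ha⟩ := exists_embedding_of_le_card (k := 3) hc
      refine h3 ⟨a, ⟨![i, j, k], ?_⟩, fun x y => ?_⟩
      · intro x y
        fin_cases x <;> fin_cases y <;> simp [hij, hij.symm, hik, hik.symm, hjk, hjk.symm]
      · have := ha x
        simp only [mem_compl, mem_union, not_or] at this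
        fin_cases y
        exacts [this.1.1, this.1.2, this.2]

theorem mBipartiteArrows_iff_forall_not_isGoodFamily {m n : ℕ} :
    MBipartiteArrows m n (KBip 2 2) (KBip 3 3) ↔
      ∀ c : Fin n → Finset (Fin m), ¬ IsGoodFamily c := by
  classical
  simp only [MBipartiteArrows, kBip_isContained_labelGraph_iff two_pos,
    kBip_isContained_labelGraph_iff three_pos, isGoodFamily_iff, not_and_or, not_not]
  constructor
  · intro h c
    have := h fun e => decide (∃ i j, e.1 = s(Sum.inl i, Sum.inr j) ∧ i ∈ c j)
    simpa using this
  · intro h C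
    have := h fun j => {i | C ⟨s(Sum.inl i, Sum.inr j),
          SimpleGraph.adj_completeBipartiteGraph_inl_inr _ _⟩ = true}
    simpa using this

theorem IsGoodFamily.restrict {m n m' n' : ℕ} {c : Fin n' → Finset (Fin m')} (hc : IsGoodFamily c)
    (a : Fin m ↪ Fin m') (b : Fin n ↪ Fin n') :
    IsGoodFamily fun j => (c (b j)).preimage a a.injective.injOn := by
  rw [isGoodFamily_iff] at hc ⊢
  refine ⟨fun ⟨a', b', h⟩ => hc.1 ⟨a'.trans a, b'.trans b, fun i j => ?_⟩,
    fun ⟨a', b', h⟩ => hc.2 ⟨a'.trans a, b'.trans b, fun i j => ?_⟩⟩ <;>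
  simpa using h i j

theorem MBipartiteArrows.mono {m n m' n' : ℕ} (hm : m ≤ m') (hn : n ≤ n')
    (h : MBipartiteArrows m n (KBip 2 2) (KBip 3 3)) :
    MBipartiteArrows m' n' (KBip 2 2) (KBip 3 3) := by
  rw [mBipartiteArrows_iff_forall_not_isGoodFamily] at h ⊢
  exact fun c hc => h _ (hc.restrict (Fin.castLEEmb hm) (Fin.castLEEmb hn))

theorem isMBipartiteRamseyNumber_succ {m₁ m m₂ N : ℕ} (h₁ : m₁ ≤ m) (h₂ : m ≤ m₂)
    (hup : MBipartiteArrows m₁ (N + 1) (KBip 2 2) (KBip 3 3))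
    (hlow : ¬ MBipartiteArrows m₂ N (KBip 2 2) (KBip 3 3)) :
    IsMBipartiteRamseyNumber m (KBip 2 2) (KBip 3 3) (N + 1) := by
  refine ⟨⟨N.succ_pos, hup.mono h₁ le_rfl⟩, fun n hn => ?_⟩
  by_contra! hlt
  exact hlow (hn.2.mono h₂ (Nat.le_of_lt_succ hlt))

/-- Colouring a single row red avoids both a red `K_{2,2}` and, when there are at most three rows,
a blue `K_{3,3}`. -/
theorem not_mBipartiteArrows_of_le_three {m : ℕ} (hm : m ≤ 3) (n : ℕ) :
    ¬ MBipartiteArrows m n (KBip 2 2) (KBip 3 3) := by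
  suffices ¬ MBipartiteArrows 3 n (KBip 2 2) (KBip 3 3) from fun h => this (h.mono hm le_rfl)
  rw [mBipartiteArrows_iff_forall_not_isGoodFamily]
  push Not
  exact ⟨fun _ => {0}, fun _ _ _ => by simp, fun _ _ _ _ _ _ => by simp [card_compl]⟩

/-! ### Families as lists of bit masks -/

/-- The bit mask of a set of rows. -/
def maskOf {m : ℕ} (s : Finset (Fin m)) : ℕ := Nat.ofBits fun i => decide (i ∈ s)

/-- The number of the lowest `m` bits of `x` that are set. -/
def popCount (m x : ℕ) : ℕ :=
  m.rec 0 fun i ih => ih + bif x.testBit i then 1 else 0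

/-- The set of rows of a bit mask. -/
def rowsOf (m x : ℕ) : Finset (Fin m) := {i | x.testBit i}

theorem card_rowsOf (m x : ℕ) : #(rowsOf m x) = popCount m x := by
  induction m with
  | zero => rfl
  | succ m ih =>
    have h : popCount (m + 1) x = popCount m x + bif x.testBit m then 1 else 0 := rfl
    rw [h, ← ih, rowsOf, rowsOf, card_filter, card_filter, Fin.sum_univ_castSucc]
    simp [Bool.cond_eq_ite]

theorem maskOf_lt {m : ℕ} (s : Finset (Fin m)) : maskOf s < 2 ^ m := Nat.ofBits_lt_two_pow _

theorem rowsOf_maskOf {m : ℕ} (s : Finset (Fin m)) : rowsOf m (maskOf s) = s := by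
  ext i
  simp [rowsOf, maskOf]

theorem rowsOf_land (m x y : ℕ) : rowsOf m (Nat.land x y) = rowsOf m x ∩ rowsOf m y := by
  ext i
  change i ∈ rowsOf m (x &&& y) ↔ _
  simp [rowsOf]

theorem rowsOf_lor (m x y : ℕ) : rowsOf m (Nat.lor x y) = rowsOf m x ∪ rowsOf m y := by
  ext i
  change i ∈ rowsOf m (x ||| y) ↔ _
  simp [rowsOf]

theorem isGoodFamily_rowsOf_iff {m n : ℕ} (x : Fin n → ℕ) :
    IsGoodFamily (fun j => rowsOf m (x j)) ↔
      (∀ i j, i ≠ j → popCount m (Nat.land (x i) (x j)) ≤ 1) ∧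
      ∀ i j k, i ≠ j → i ≠ k → j ≠ k →
        m ≤ popCount m (Nat.lor (Nat.lor (x i) (x j)) (x k)) + 2 := by
  simp only [IsGoodFamily, ← card_rowsOf, rowsOf_land, rowsOf_lor, card_compl, Fintype.card_fin,
    Nat.sub_le_iff_le_add, Nat.add_comm 2]

/-! ### Explicit colourings for the lower bounds -/

theorem not_mBipartiteArrows_of_masks {m n : ℕ} (x : Fin n → ℕ)
    (h : (∀ i j, i ≠ j → popCount m (Nat.land (x i) (x j)) ≤ 1) ∧
      ∀ i j k, i ≠ j → i ≠ k → j ≠ k →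
        m ≤ popCount m (Nat.lor (Nat.lor (x i) (x j)) (x k)) + 2) :
    ¬ MBipartiteArrows m n (KBip 2 2) (KBip 3 3) := fun h' =>
  mBipartiteArrows_iff_forall_not_isGoodFamily.1 h' _ ((isGoodFamily_rowsOf_iff x).2 h)

/-- All six pairs of rows, and each singleton twice: three members always cover at least two rows.
-/
theorem not_mBipartiteArrows_four_fourteen :
    ¬ MBipartiteArrows 4 14 (KBip 2 2) (KBip 3 3) :=
  not_mBipartiteArrows_of_masks ![3, 5, 6, 9, 10, 12, 1, 1, 2, 2, 4, 4, 8, 8] (by decide +kernel)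

/-- Two disjoint triples and the nine pairs joining them. The pairs contain no triangle, so three of
them cover at least four rows. -/
theorem not_mBipartiteArrows_six_eleven :
    ¬ MBipartiteArrows 6 11 (KBip 2 2) (KBip 3 3) :=
  not_mBipartiteArrows_of_masks ![7, 56, 9, 17, 33, 10, 18, 34, 12, 20, 36] (by decide +kernel)

/-- The Möbius–Kantor configuration: triples meeting pairwise in at most one point, so three of them
cover at least 9 - 3 = 6 rows. -/
theorem not_mBipartiteArrows_eight_eight :
    ¬ MBipartiteArrows 8 8 (KBip 2 2) (KBip 3 3) :=
  not_mBipartiteArrows_of_masks ![7, 25, 42, 76, 112, 146, 164, 193] (by decide +kernel)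

/-! ### Exhaustive search for good families

The search functions are written with recursors and the `Nat` operations that the kernel
accelerates, since they are evaluated by kernel reduction. -/

/-- The bit of `table` at position `x`. -/
def lookupBit (table x : ℕ) : Bool := Nat.beq (Nat.land 1 (Nat.shiftRight table x)) 1

/-- Whether the mask `b` can be added to the masks `chosen` and `c`. -/
def fitsWith (lo hi : ℕ) (chosen : List ℕ) (c b : ℕ) : Bool :=
  bif lookupBit lo (Nat.land b c) then
    chosen.rec true fun d _ ih => bif lookupBit hi (Nat.lor d (Nat.lor b c)) then ih else false
  else false

/-- `List.filter`, in a form that the kernel reduces quickly. -/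
def keepIf (p : ℕ → Bool) (l : List ℕ) : List ℕ :=
  l.rec [] fun b _ ih => bif p b then b :: ih else ih

/-- Whether `f` holds of some nonempty suffix of a list. -/
def anySuffix (f : ℕ → List ℕ → Bool) (l : List ℕ) : Bool :=
  l.rec false fun b cs ih => bif f b cs then true else ih

/-- Whether `n` further masks, taken from `cands` with repetition allowed, can be added to the
masks `chosen`. -/
def canExtend (lo hi n : ℕ) : List ℕ → List ℕ → Bool :=
  n.rec (fun _ _ => true) fun _ ih cands chosen =>
    anySuffix (fun c cs => ih (keepIf (fitsWith lo hi chosen c) (c :: cs)) (c :: chosen)) cands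

theorem mem_keepIf {p : ℕ → Bool} {l : List ℕ} {x : ℕ} (hx : x ∈ l) (hp : p x) :
    x ∈ keepIf p l := by
  induction l with
  | nil => simp at hx
  | cons b l ih =>
    have h : keepIf p (b :: l) = bif p b then b :: keepIf p l else keepIf p l := rfl
    rw [h]
    rcases List.mem_cons.1 hx with rfl | hx
    · simp [hp]
    · cases p b <;> simp [ih hx]

theorem fitsWith_eq_true {lo hi c b : ℕ} {chosen : List ℕ} (h2 : lookupBit lo (Nat.land b c))
    (h3 : ∀ d ∈ chosen, lookupBit hi (Nat.lor d (Nat.lor b c))) :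
    fitsWith lo hi chosen c b = true := by
  rw [fitsWith, h2, cond_true]
  induction chosen with
  | nil => rfl
  | cons d l ih =>
    change (bif lookupBit hi (Nat.lor d (Nat.lor b c)) then _ else false) = true
    rw [h3 d (by simp), cond_true]
    exact ih fun d hd => h3 d (by simp [hd])

/-- Completeness of the search, the only direction needed. The invariant is that the masks of the
unplaced indices `s` all lie in `cands`. A head that is no such mask can be dropped. Otherwise it is
chosen, and it stays a candidate because columns may have equal neighbourhoods. -/
theorem canExtend_eq_true {ι : Type*} [DecidableEq ι] {lo hi : ℕ} (x : ι → ℕ)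
    (h2 : ∀ i j, i ≠ j → lookupBit lo (Nat.land (x i) (x j)))
    (h3 : ∀ i j k, i ≠ j → i ≠ k → j ≠ k → lookupBit hi (Nat.lor (x i) (Nat.lor (x j) (x k))))
    (n : ℕ) (s : Finset ι) (D : List ι) (cands : List ℕ) (hs : #s = n) (hD : ∀ d ∈ D, d ∉ s)
    (hc : ∀ i ∈ s, x i ∈ cands) : canExtend lo hi n cands (D.map x) = true := by
  induction n generalizing s D cands with
  | zero => rfl
  | succ n ih =>
    change anySuffix _ cands = true
    induction cands with
    | nil =>
      obtain ⟨i, hi⟩ := card_pos.1 (by omega : 0 < #s)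
      simpa using hc i hi
    | cons c cs ihc =>
      change (bif canExtend lo hi n (keepIf (fitsWith lo hi (D.map x) c) (c :: cs))
        (c :: D.map x) then true else _) = true
      by_cases hex : ∃ i ∈ s, x i = c
      · obtain ⟨i, his, rfl⟩ := hex
        have : canExtend lo hi n (keepIf (fitsWith lo hi (D.map x) (x i)) (x i :: cs))
            (x i :: D.map x) = true := by
          refine ih (s.erase i) (i :: D) _ (by simp [his, hs]) ?_ ?_
          · intro d hd
            rcases List.mem_cons.1 hd with rfl | hd
            · simp
            · exact fun h => hD d hd (mem_of_mem_erase h)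
          · intro j hj
            obtain ⟨hji, hjs⟩ := mem_erase.1 hj
            refine mem_keepIf (hc j hjs) (fitsWith_eq_true (h2 j i hji) ?_)
            intro y hy
            obtain ⟨d, hd, rfl⟩ := List.mem_map.1 hy
            refine h3 d j i ?_ ?_ hji
            · rintro rfl; exact hD _ hd hjs
            · rintro rfl; exact hD _ hd his
        rw [this, cond_true]
      · push Not at hex
        have := ihc fun i hi => (List.mem_cons.1 (hc i hi)).resolve_left (hex i hi)
        cases canExtend lo hi n (keepIf (fitsWith lo hi (D.map x) c) (c :: cs)) (c :: D.map x)
        · exact this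
        · rfl

/-- The masks of `m` rows whose number of rows is in the list `ks`. -/
def masksOfSizes (m : ℕ) (ks : List ℕ) : List ℕ :=
  ks.flatMap fun k => (List.range (2 ^ m)).filter fun x => (popCount m x).beq k

/-- Whether a good family of `n + 1` sets of sizes in `ks` exists, where the first member is the
initial segment of some size `k` and sizes before `k` in `ks` are not used. -/
def existsFamily (lo hi m n : ℕ) (ks : List ℕ) : Bool :=
  ks.rec false fun k ks ih =>
    bif canExtend lo hi n
      (keepIf (fitsWith lo hi [] (2 ^ k - 1)) (masksOfSizes m (k :: ks))) [2 ^ k - 1]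
    then true else ih

theorem mem_masksOfSizes {m : ℕ} {ks : List ℕ} {s : Finset (Fin m)} (h : #s ∈ ks) :
    maskOf s ∈ masksOfSizes m ks := by
  refine List.mem_flatMap.2 ⟨_, h, List.mem_filter.2 ⟨List.mem_range.2 (maskOf_lt s), ?_⟩⟩
  rw [← card_rowsOf, rowsOf_maskOf, Nat.beq_eq]

theorem maskOf_filter_lt {m k : ℕ} (hk : k ≤ m) :
    maskOf ({i | i.val < k} : Finset (Fin m)) = 2 ^ k - 1 := by
  refine Nat.eq_of_testBit_eq fun i => ?_
  rw [maskOf, Nat.testBit_two_pow_sub_one]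
  by_cases hi : i < m
  · rw [Nat.testBit_ofBits_lt _ _ hi]
    simp
  · rw [Nat.testBit_ofBits_ge _ _ (not_lt.1 hi)]
    simp; omega

theorem IsGoodFamily.map {m n : ℕ} {c : Fin n → Finset (Fin m)} (hc : IsGoodFamily c)
    (σ : Equiv.Perm (Fin m)) : IsGoodFamily fun j => (c j).map σ.toEmbedding := by
  convert hc.restrict σ.symm.toEmbedding (.refl _) using 2 with j
  ext i
  simp

theorem existsFamily_eq_true {m n lo hi : ℕ}
    (hlo : ∀ x < 2 ^ m, popCount m x ≤ 1 → lookupBit lo x)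
    (hhi : ∀ x < 2 ^ m, m ≤ popCount m x + 2 → lookupBit hi x) (ks : List ℕ)
    {c : Fin (n + 1) → Finset (Fin m)} (hc : IsGoodFamily c) (hks : ∀ j, #(c j) ∈ ks) :
    existsFamily lo hi m n ks = true := by
  induction ks with
  | nil => simpa using hks 0
  | cons k ks ih =>
    change (bif canExtend lo hi n
      (keepIf (fitsWith lo hi [] (2 ^ k - 1)) (masksOfSizes m (k :: ks))) [2 ^ k - 1]
      then true else existsFamily lo hi m n ks) = true
    by_cases hex : ∃ j, #(c j) = k
    · obtain ⟨j, hj⟩ := hex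
      have hkm : k ≤ m := by simpa [hj] using card_le_univ (c j)
      -- Goodness is invariant under row permutations, so a member of size `k` may be taken to be
      -- the first `k` rows.
      obtain ⟨σ, hσ⟩ := Equiv.Perm.exists_map_finset_eq (c j) {i | i.val < k} (by
        rw [hj, Fin.card_filter_val_lt, min_eq_right hkm])
      have hc' := hc.map σ
      set c' := fun j => (c j).map σ.toEmbedding
      have hland : ∀ s t : Finset (Fin m), Nat.land (maskOf s) (maskOf t) < 2 ^ m := fun s t =>
        Nat.and_lt_two_pow _ (maskOf_lt t)
      have hlor : ∀ s t u : Finset (Fin m),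
          Nat.lor (maskOf s) (Nat.lor (maskOf t) (maskOf u)) < 2 ^ m := fun s t u =>
        Nat.or_lt_two_pow (maskOf_lt s) (Nat.or_lt_two_pow (maskOf_lt t) (maskOf_lt u))
      have h2 : ∀ i j, i ≠ j → lookupBit lo (Nat.land (maskOf (c' i)) (maskOf (c' j))) :=
        fun i j hij => hlo _ (hland _ _) (by
          rw [← card_rowsOf, rowsOf_land, rowsOf_maskOf, rowsOf_maskOf]
          exact hc'.1 i j hij)
      have h3 : ∀ i j k, i ≠ j → i ≠ k → j ≠ k →
          lookupBit hi (Nat.lor (maskOf (c' i)) (Nat.lor (maskOf (c' j)) (maskOf (c' k)))) :=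
        fun i j k hij hik hjk => hhi _ (hlor _ _ _) (by
          have := hc'.2 i j k hij hik hjk
          rw [card_compl, Fintype.card_fin] at this
          rw [← card_rowsOf, rowsOf_lor, rowsOf_lor, rowsOf_maskOf, rowsOf_maskOf, rowsOf_maskOf,
            ← union_assoc]
          omega)
      have hmask : maskOf (c' j) = 2 ^ k - 1 := by simp only [c', hσ, maskOf_filter_lt hkm]
      have := canExtend_eq_true (fun j => maskOf (c' j)) h2 h3 n (univ.erase j) [j]
        (keepIf (fitsWith lo hi [] (2 ^ k - 1)) (masksOfSizes m (k :: ks))) (by simp) (by simp)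
        (fun i hi => mem_keepIf (mem_masksOfSizes (by simpa [c'] using hks i))
          (fitsWith_eq_true (hmask ▸ h2 i j (ne_of_mem_erase hi)) (by simp)))
      rw [List.map_singleton, hmask] at this
      rw [this, cond_true]
    -- No member has size `k`, so that size is discarded for the rest of the search.
    · push Not at hex
      rw [ih fun j => (List.mem_cons.1 (hks j)).resolve_left (hex j)]
      cases canExtend lo hi n _ [2 ^ k - 1] <;> rfl

/-! ### Upper bounds by evaluating the search -/

theorem mBipartiteArrows_of_existsFamily_eq_false {m n lo hi : ℕ} (ks : List ℕ)
    (hks : ∀ k ≤ m, k ∈ ks) (hlo : ∀ x < 2 ^ m, popCount m x ≤ 1 → lookupBit lo x)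
    (hhi : ∀ x < 2 ^ m, m ≤ popCount m x + 2 → lookupBit hi x)
    (h : existsFamily lo hi m n ks = false) :
    MBipartiteArrows m (n + 1) (KBip 2 2) (KBip 3 3) := by
  rw [mBipartiteArrows_iff_forall_not_isGoodFamily]
  intro c hc
  have := existsFamily_eq_true hlo hhi ks hc fun j => hks _ (by simpa using card_le_univ (c j))
  simp [h] at this

/-- The bits of 279 are 0, 1, 2, 4, 8, the masks with at most one row. The bits of 65256 are the
masks with at least two rows. Correctness does not depend on the order of the sizes. -/
theorem mBipartiteArrows_four_fifteen : MBipartiteArrows 4 15 (KBip 2 2) (KBip 3 3) :=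
  mBipartiteArrows_of_existsFamily_eq_false (lo := 279) (hi := 65256) [3, 4, 1, 0, 2]
    (by decide) (by decide +kernel) (by decide +kernel) (by decide +kernel)

theorem mBipartiteArrows_five_twelve : MBipartiteArrows 5 12 (KBip 2 2) (KBip 3 3) :=
  mBipartiteArrows_of_existsFamily_eq_false (lo := 65815) (hi := 4276676736) [3, 4, 1, 2, 0, 5]
    (by decide) (by decide +kernel) (by decide +kernel) (by decide +kernel)

set_option maxHeartbeats 4000000 in
theorem mBipartiteArrows_seven_nine : MBipartiteArrows 7 9 (KBip 2 2) (KBip 3 3) :=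
  mBipartiteArrows_of_existsFamily_eq_false (lo := 18446744078004584727)
    (hi := 338833239532737430003885703342063616000) [4, 5, 6, 7, 0, 1, 2, 3]
    (by decide) (by decide +kernel) (by decide +kernel) (by decide +kernel)

theorem theorem1 (m : ℕ) (hm : 2 ≤ m) :
    ((m = 2 ∨ m = 3) → ¬ ∃ N : ℕ, IsMBipartiteRamseyNumber m (KBip 2 2) (KBip 3 3) N) ∧
    (m = 4 → IsMBipartiteRamseyNumber m (KBip 2 2) (KBip 3 3) 15) ∧
    ((m = 5 ∨ m = 6) → IsMBipartiteRamseyNumber m (KBip 2 2) (KBip 3 3) 12) ∧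
    ((m = 7 ∨ m = 8) → IsMBipartiteRamseyNumber m (KBip 2 2) (KBip 3 3) 9) := by
  refine ⟨fun h => ?_, ?_, ?_, ?_⟩
  · rintro ⟨N, hN⟩
    exact not_mBipartiteArrows_of_le_three (by omega) N hN.1.2
  · rintro rfl
    exact isMBipartiteRamseyNumber_succ le_rfl le_rfl mBipartiteArrows_four_fifteen
      not_mBipartiteArrows_four_fourteen
  · intro h
    exact isMBipartiteRamseyNumber_succ (by omega) (by omega) mBipartiteArrows_five_twelve
      not_mBipartiteArrows_six_eleven
  · intro h
    exact isMBipartiteRamseyNumber_succ (by omega) (by omega) mBipartiteArrows_seven_nine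
      not_mBipartiteArrows_eight_eight
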